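/- Let $r\ge 1$ and $n\ge 0$ be integers. For $m\ge 0$ consider polynomials over $\mathbb{Q}$ in $r$ sets of $m$ variables $\mathbf{x}=x_1,\ldots,x_m$, $\mathbf{y}=y_1,\ldots,y_m$, etc., on which $\mathbb{S}_m$ acts diagonally: $\sigma$ sends $u_i$ to $u_{\sigma(i)}$ for each set of variables $\mathbf{u}$. For a polynomial $p$, let $\mathcal{L}_{\partial,E}[p]$ be the smallest $\mathbb{Q}$-vector space that contains $p$ and is closed under all partial derivatives and under the operators $E_{\mathbf{u}\mathbf{v}}^{(k)}=\sum_{i=1}^m u_i\,\partial_{v_i}^k$, for any two distinct sets of variables $\mathbf{u},\mathbf{v}$ among the $r$ sets and any $k\ge 1$. Let $\Delta_m(\mathbf{x})$ be the Vandermonde determinant in $x_1,\ldots,x_m$, let $e_n(\mathbf{x})=x_1\cdots x_n$, and put $$\mathrm{Diag}[n;n]:=\mathcal{L}_{\partial,E}[e_n(\mathbf{x})\,\Delta_n(\mathbf{x})],\qquad \mathrm{Diag}[n+1]:=\mathcal{L}_{\partial,E}[\Delta_{n+1}(x_1,\ldots,x_{n+1})].$$ These are respectively an $\mathbb{S}_n$-module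 and an $\mathbb{S}_{n+1}$-module. For a homogeneous component of vector degree $\mathbf{d}\in\mathbb{N}^r$ (degree in $\mathbf{x}$, degree in $\mathbf{y}$, etc.) of such a module $\mathscr{V}$ over $\mathbb{S}_m$, let $\mathscr{V}_{\mathbf{d}}(\mathbf{w})=\frac{1}{m!}\sum_{\sigma\in\mathbb{S}_m}\chi_{\mathscr{V}_{\mathbf{d}}}(\sigma)\,p_{\lambda(\sigma)}(\mathbf{w})$ be its Frobenius characteristic, where $\chi_{\mathscr{V}_{\mathbf{d}}}$ is the character, $\lambda(\sigma)$ is the cycle type of $\sigma$, and $p_\lambda$ is the power sum symmetric function; and let $\mathscr{V}(\mathbf{w};\mathbf{q})=\sum_{\mathbf{d}} q_1^{d_1}\cdots q_r^{d_r}\,\mathscr{V}_{\mathbf{d}}(\mathbf{w})$. Let $\partial p_1$ be the operator that expands a symmetric function as a polynomial in the power sums $p_1,p_2,\ldots$ and differentiates it with respect to $p_1$, extended coefficientwise to series in $\mathbf{q}$. Then $\mathrm{Diag}[n;n]$ and $\mathrm{Diag}[n+1]$ are each the direct sum of their homogeneous components for the vector degree, and there is an isomorphism of $\mathbb{S}_n$-modules,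 preserving the vector degree, from $\mathrm{Diag}[n;n]$ to the restriction of $\mathrm{Diag}[n+1]$ to $\mathbb{S}_n$ (the permutations of the first $n$ indices). Moreover $$\mathrm{Diag}[n;n](\mathbf{w};\mathbf{q})=\partial p_1\,\mathrm{Diag}[n+1](\mathbf{w};\mathbf{q}).$$ -/

import Mathlib

noncomputable section

namespace DiagonalModules

open MvPolynomial

/-- The power sum `p_k = ∑ i, w_i ^ k` (for `k ≥ 1`) in the variables `w_0, w_1, …`. -/
def powerSum (k : ℕ) : MvPowerSeries ℕ ℚ := by
  classical exact fun m => if ∃ i, m = Finsupp.single i k then 1 else 0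

theorem pderiv_powerSum (i k : ℕ) :
    MvPowerSeries.pderiv ℚ i (powerSum (k + 1)) =
      ((k : ℚ) + 1) • (MvPowerSeries.X i : MvPowerSeries ℕ ℚ) ^ k := by
  classical
  ext m
  rw [MvPowerSeries.coeff_pderiv, map_smul, MvPowerSeries.coeff_X_pow]
  have h : MvPowerSeries.coeff (m + Finsupp.single i 1) (powerSum (k + 1)) =
      if ∃ j, m + Finsupp.single i 1 = Finsupp.single j (k + 1) then 1 else 0 := rfl
  rw [h]
  have h2 : (∃ j, m + Finsupp.single i 1 = Finsupp.single j (k + 1)) ↔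
      m = Finsupp.single i k := by
    constructor
    · rintro ⟨j, hj⟩
      have hij : j = i := by
        by_contra hne
        have := DFunLike.congr_fun hj i
        simp [hne] at this
      subst hij
      rw [Finsupp.single_add] at hj
      exact add_right_cancel hj
    · rintro rfl
      exact ⟨i, by rw [← Finsupp.single_add]⟩
  simp only [h2]
  split_ifs with h3
  · subst h3
    simp
  · simp

theorem derivation_aeval {N : ℕ} (x : Fin N → MvPowerSeries ℕ ℚ) (i : ℕ)
    (P : MvPolynomial (Fin N) ℚ) :
    MvPowerSeries.pderiv ℚ i (aeval x P) =
      ∑ k, aeval x (pderiv k P) * MvPowerSeries.pderiv ℚ i (x k) := by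
  induction P using MvPolynomial.induction_on with
  | C a => simp
  | add p q hp hq => simp [hp, hq, add_mul, Finset.sum_add_distrib]
  | mul_X p j hp =>
    simp only [map_mul, aeval_X, Derivation.leibniz, hp, smul_eq_mul, pderiv_X, map_add, add_mul,
      Finset.sum_add_distrib, Finset.mul_sum]
    congr 1
    · rw [Finset.sum_eq_single j]
      · simp
      · intro b _ hb
        simp [hb.symm]
      · simp
    · refine Finset.sum_congr rfl fun k _ => by ring

theorem eq_C_of_pderiv_eq_zero {σ : Type*} (P : MvPolynomial σ ℚ) (h : ∀ k, pderiv k P = 0) :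
    P = C (coeff 0 P) := by
  classical
  ext m
  rw [coeff_C]
  split_ifs with hm
  · rw [hm]
  · obtain ⟨i, hi⟩ : ∃ i, m i ≠ 0 := by
      by_contra hc
      push Not at hc
      exact hm (by ext i; simp [hc i])
    have h1 := congrArg (coeff (m - Finsupp.single i 1)) (h i)
    rw [coeff_pderiv, tsub_add_cancel_of_le
      (Finsupp.single_le_iff.mpr (Nat.one_le_iff_ne_zero.mpr hi))] at h1
    rw [coeff_zero] at h1
    rcases mul_eq_zero.mp h1 with h2 | h2
    · exact h2
    · exact absurd h2 (by positivity)

theorem totalDegree_pderiv_le_of_succ {σ : Type*} (P : MvPolynomial σ ℚ) (k : σ) (d : ℕ)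
    (h : P.totalDegree ≤ d + 1) : (pderiv k P).totalDegree ≤ d := by
  classical
  refine Finset.sup_le fun m hm => ?_
  rw [mem_support_iff, coeff_pderiv] at hm
  have h1 := le_totalDegree (mem_support_iff.mpr (left_ne_zero_of_mul hm))
  rw [Finsupp.sum_add_index' (fun _ => rfl) (fun _ _ _ => rfl)] at h1
  simp at h1
  omega

theorem algebraicIndependent_powerSum_fin (N : ℕ) :
    AlgebraicIndependent ℚ fun k : Fin N => powerSum (k + 1) := by
  rw [algebraicIndependent_iff]
  have hdom : IsDomain (MvPowerSeries ℕ ℚ) := NoZeroDivisors.to_isDomain _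
  suffices h : ∀ d (P : MvPolynomial (Fin N) ℚ), P.totalDegree ≤ d →
      aeval (fun k : Fin N => powerSum (k + 1)) P = 0 → P = 0 from fun P => h _ P le_rfl
  intro d
  induction d with
  | zero =>
    intro P hd hP
    rw [totalDegree_eq_zero_iff_eq_C.mp (Nat.le_zero.mp hd)] at hP ⊢
    simpa using hP
  | succ d ih =>
    intro P hd hP
    have key : ∀ k, pderiv k P = 0 := by
      have hv : (fun k : Fin N => ((k : ℚ) + 1) •
          aeval (fun k : Fin N => powerSum (k + 1)) (pderiv k P)) = 0 := by
        refine Matrix.eq_zero_of_forall_index_sum_pow_mul_eq_zero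
          (f := fun i : Fin N => (MvPowerSeries.X (i : ℕ) : MvPowerSeries ℕ ℚ)) ?_ ?_
        · intro a b hab
          exact Fin.ext (MvPowerSeries.X_inj.mp hab)
        · intro i
          have := derivation_aeval (fun k : Fin N => powerSum (k + 1)) (i : ℕ) P
          rw [hP, map_zero] at this
          rw [this]
          refine Finset.sum_congr rfl fun k _ => ?_
          rw [pderiv_powerSum]
          simp [mul_comm]
      intro k
      apply ih _ (totalDegree_pderiv_le_of_succ P k d hd)
      have h1 := congrFun hv k
      exact (smul_eq_zero.mp h1).resolve_left (by positivity)
    have hC := eq_C_of_pderiv_eq_zero P key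
    rw [hC] at hP ⊢
    simpa using hP

theorem algebraicIndependent_powerSum : AlgebraicIndependent ℚ fun k : ℕ => powerSum (k + 1) := by
  rw [algebraicIndependent_iff]
  intro P hP
  obtain ⟨N, hN⟩ : ∃ N, ∀ i ∈ P.vars, i < N :=
    ⟨P.vars.sup id + 1, fun i hi => Nat.lt_succ_of_le (Finset.le_sup (f := id) hi)⟩
  obtain ⟨Q, rfl⟩ := exists_rename_eq_of_vars_subset_range P (Fin.val : Fin N → ℕ)
    Fin.val_injective (fun i hi => ⟨⟨i, hN i hi⟩, rfl⟩)
  rw [aeval_rename] at hP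
  rw [algebraicIndependent_iff.mp (algebraicIndependent_powerSum_fin N) Q hP, map_zero]

/-- The ring `Λ` of symmetric functions over `ℚ` in `w_0, w_1, …`: over a field of characteristic
zero it is generated by the power sums `p_1, p_2, …`. -/
def SymmFun : Subalgebra ℚ (MvPowerSeries ℕ ℚ) :=
  Algebra.adjoin ℚ (Set.range fun k : ℕ => powerSum (k + 1))

theorem powerSum_zero : powerSum 0 = 1 := by
  classical
  ext m
  rw [MvPowerSeries.coeff_one]
  have h : MvPowerSeries.coeff m (powerSum 0) =
      if ∃ j, m = Finsupp.single j 0 then 1 else 0 := rfl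
  rw [h]
  simp

theorem powerSum_mem (k : ℕ) : powerSum k ∈ SymmFun := by
  cases k with
  | zero => rw [powerSum_zero]; exact one_mem _
  | succ k => exact Algebra.subset_adjoin ⟨k, rfl⟩

/-- The power sum `p_k` as an element of `Λ` (used for `k ≥ 1`). -/
def psumSymm (k : ℕ) : SymmFun := ⟨powerSum k, powerSum_mem k⟩

/-- `Λ = ℚ[p_1, p_2, …]`; the variable `X k` of the polynomial ring corresponds to `p_{k+1}`. -/
def powerSumEquiv : MvPolynomial ℕ ℚ ≃ₐ[ℚ] SymmFun :=
  algebraicIndependent_powerSum.aevalEquiv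

/-- The operator `∂p_1` on `Λ`: expand a symmetric function as a polynomial in the power sums
`p_1, p_2, …`, and differentiate formally with respect to `p_1`. -/
def dp1 : SymmFun →ₗ[ℚ] SymmFun :=
  powerSumEquiv.toLinearMap ∘ₗ (pderiv 0 : Derivation ℚ (MvPolynomial ℕ ℚ) _).toLinearMap ∘ₗ
    powerSumEquiv.symm.toLinearMap

/-- The Frobenius characteristic of a finite-dimensional representation of `S_n`,
`(1 / n!) ∑_σ χ(σ) p_{λ(σ)}`, where `λ(σ)` is the cycle type of `σ` (fixed points included). -/
def frobChar {n : ℕ} {V : Type*} [AddCommGroup V] [Module ℚ V]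
    (ρ : Representation ℚ (Equiv.Perm (Fin n)) V) : SymmFun :=
  (1 / (n.factorial : ℚ)) •
    ∑ σ : Equiv.Perm (Fin n), ρ.character σ • (σ.partition.parts.map psumSymm).prod

/-- Polynomials over `ℚ` in `r` sets of `n` variables; `X (u, i)` is the `i`-th variable of the
set number `u`. -/
abbrev Poly (r n : ℕ) : Type := MvPolynomial (Fin r × Fin n) ℚ

/-- The diagonal permutation of variables: `σ` sends `u_i` to `u_{σ(i)}`, for every set `u`. -/
def permVars (r : ℕ) {n : ℕ} (σ : Equiv.Perm (Fin n)) : Poly r n →ₐ[ℚ] Poly r n :=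
  rename (Prod.map id σ)

/-- The diagonal action of `S_n` on polynomials in `r` sets of `n` variables. -/
def diagAction (r n : ℕ) : Representation ℚ (Equiv.Perm (Fin n)) (Poly r n) where
  toFun σ := (permVars r σ).toLinearMap
  map_one' := by
    refine LinearMap.ext fun p => ?_
    have h : (Prod.map id ((1 : Equiv.Perm (Fin n)) : Fin n → Fin n) : Fin r × Fin n → _) = id := by
      ext x <;> rfl
    rw [AlgHom.toLinearMap_apply, permVars, h, rename_id_apply, Module.End.one_apply]
  map_mul' σ τ := by
    refine LinearMap.ext fun p => ?_
    rw [Module.End.mul_apply, AlgHom.toLinearMap_apply, AlgHom.toLinearMap_apply,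
      AlgHom.toLinearMap_apply, permVars, permVars, permVars, rename_rename, Prod.map_comp_map]
    rfl

theorem diagAction_apply {r n : ℕ} (σ : Equiv.Perm (Fin n)) (p : Poly r n) :
    diagAction r n σ p = permVars r σ p := rfl

/-- The operator `E_{uv}^{(k)} = ∑ i, u_i (∂ / ∂ v_i) ^ k`. -/
def opE {r n : ℕ} (u v : Fin r) (k : ℕ) : Module.End ℚ (Poly r n) :=
  ∑ i : Fin n, LinearMap.mulLeft ℚ (X (u, i)) ∘ₗ ((pderiv (v, i)).toLinearMap ^ k)

/-- `W` is closed under all partial derivatives and under the operators `E_{uv}^{(k)}`, `k ≥ 1`, for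
any two of the `r` sets of variables. -/
structure IsClosedUnderOps {r n : ℕ} (W : Submodule ℚ (Poly r n)) : Prop where
  pderiv_mem : ∀ (u : Fin r) (i : Fin n), ∀ f ∈ W, pderiv (u, i) f ∈ W
  opE_mem : ∀ u v : Fin r, u ≠ v → ∀ k : ℕ, 1 ≤ k → ∀ f ∈ W, opE u v k f ∈ W

/-- `L_{∂,E}[p]`: the smallest vector space that contains `p` and is closed under partial derivatives
and under the operators `E_{uv}^{(k)}`. -/
def opSpan {r n : ℕ} (p : Poly r n) : Submodule ℚ (Poly r n) :=
  sInf {W | p ∈ W ∧ IsClosedUnderOps W}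

/-- A polynomial in `n` variables, seen as a polynomial in the first set of variables `x`. -/
def inX {r n : ℕ} [NeZero r] : MvPolynomial (Fin n) ℚ →ₐ[ℚ] Poly r n :=
  rename fun i => (0, i)

/-- The Vandermonde determinant in the first set of variables `x`. -/
def vandermondeX (r n : ℕ) [NeZero r] : Poly r n :=
  (Matrix.vandermonde fun i : Fin n => (X (0, i) : Poly r n)).det

theorem diagAction_pderiv {r n : ℕ} (σ : Equiv.Perm (Fin n)) (u : Fin r) (i : Fin n)
    (f : Poly r n) :
    pderiv (u, σ i) (diagAction r n σ f) = diagAction r n σ (pderiv (u, i) f) := by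
  rw [diagAction_apply, diagAction_apply, permVars]
  exact pderiv_rename (Function.injective_id.prodMap σ.injective) (u, i) f

theorem diagAction_pderiv_pow {r n : ℕ} (σ : Equiv.Perm (Fin n)) (u : Fin r) (i : Fin n) (k : ℕ)
    (f : Poly r n) :
    ((pderiv (u, σ i)).toLinearMap ^ k : Module.End ℚ (Poly r n)) (diagAction r n σ f) =
      diagAction r n σ (((pderiv (u, i)).toLinearMap ^ k : Module.End ℚ (Poly r n)) f) := by
  induction k generalizing f with
  | zero => rfl
  | succ k ih =>
    rw [pow_succ, pow_succ, Module.End.mul_apply, Module.End.mul_apply, ← ih]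
    exact congrArg _ (diagAction_pderiv σ u i f)

theorem diagAction_opE {r n : ℕ} (σ : Equiv.Perm (Fin n)) (u v : Fin r) (k : ℕ) (f : Poly r n) :
    opE u v k (diagAction r n σ f) = diagAction r n σ (opE u v k f) := by
  simp only [opE, LinearMap.sum_apply, map_sum, LinearMap.comp_apply, LinearMap.mulLeft_apply]
  rw [← Equiv.sum_comp σ]
  refine Finset.sum_congr rfl fun i _ => ?_
  rw [diagAction_pderiv_pow, diagAction_apply, diagAction_apply, map_mul]
  congr 1
  rw [permVars, rename_X]
  rfl

theorem diagAction_vandermondeX {r n : ℕ} [NeZero r] (σ : Equiv.Perm (Fin n)) :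
    diagAction r n σ (vandermondeX r n) = (Equiv.Perm.sign σ : ℤ) • vandermondeX r n := by
  have h : diagAction r n σ (vandermondeX r n) =
      ((Matrix.vandermonde fun i : Fin n => (X (0, i) : Poly r n)).submatrix σ id).det := by
    rw [diagAction_apply, vandermondeX, AlgHom.map_det]
    congr 1
    ext1 i j
    simp [Matrix.vandermonde, permVars]
  rw [h, Matrix.det_permute, vandermondeX, zsmul_eq_mul]

theorem diagAction_inX {r n : ℕ} [NeZero r] (σ : Equiv.Perm (Fin n))
    (f : symmetricSubalgebra (Fin n) ℚ) :
    diagAction r n σ (inX (f : MvPolynomial (Fin n) ℚ)) = inX (f : MvPolynomial (Fin n) ℚ) := by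
  have h : rename σ (f : MvPolynomial (Fin n) ℚ) = f := (mem_symmetricSubalgebra _).mp f.2 σ
  conv_rhs => rw [← h]
  rw [diagAction_apply, permVars, inX, rename_rename, rename_rename]
  rfl

theorem diagAction_opSpan {r n : ℕ} [NeZero r] (f : symmetricSubalgebra (Fin n) ℚ)
    (σ : Equiv.Perm (Fin n)) ⦃p : Poly r n⦄
    (hp : p ∈ opSpan (inX (f : MvPolynomial (Fin n) ℚ) * vandermondeX r n)) :
    diagAction r n σ p ∈ opSpan (inX (f : MvPolynomial (Fin n) ℚ) * vandermondeX r n) := by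
  rw [opSpan, Submodule.mem_sInf]
  rintro W ⟨hW, hc⟩
  have h2 : p ∈ W.comap (diagAction r n σ) := by
    refine Submodule.mem_sInf.mp hp _ ⟨?_, ?_, ?_⟩
    · have h3 : diagAction r n σ (inX (f : MvPolynomial (Fin n) ℚ) * vandermondeX r n) =
          (Equiv.Perm.sign σ : ℤ) • (inX (f : MvPolynomial (Fin n) ℚ) * vandermondeX r n) := by
        rw [← mul_smul_comm, ← diagAction_vandermondeX, diagAction_apply, map_mul,
          ← diagAction_apply, ← diagAction_apply, diagAction_inX]
      rw [Submodule.mem_comap, h3]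
      exact zsmul_mem hW _
    · intro u i g hg
      rw [Submodule.mem_comap, ← diagAction_pderiv]
      exact hc.pderiv_mem _ _ _ hg
    · intro u v huv k hk g hg
      rw [Submodule.mem_comap, ← diagAction_opE]
      exact hc.opE_mem u v huv k hk _ hg
  exact h2

/-- The `S_n`-module `Diag[n; f] = L_{∂,E}[f(x) Δ_n(x)]`, for a symmetric polynomial `f` and `r` sets
of variables. -/
def Diag (r n : ℕ) [NeZero r] (f : symmetricSubalgebra (Fin n) ℚ) :
    Subrepresentation (diagAction r n) where
  toSubmodule := opSpan (inX (f : MvPolynomial (Fin n) ℚ) * vandermondeX r n)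
  apply_mem_toSubmodule σ _ hp := diagAction_opSpan f σ hp

/-- The `S_n`-module of polynomials that are homogeneous of vector degree `d`, that is of degree
`d u` in the set of variables number `u`, for every `u`. -/
def homogeneousPart (r n : ℕ) (d : Fin r →₀ ℕ) : Subrepresentation (diagAction r n) where
  toSubmodule := weightedHomogeneousSubmodule ℚ
    (fun p : Fin r × Fin n => (Finsupp.single p.1 1 : Fin r →₀ ℕ)) d
  apply_mem_toSubmodule σ p hp := by
    classical
    rw [mem_weightedHomogeneousSubmodule] at hp ⊢
    intro m hm
    rw [diagAction_apply, permVars] at hm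
    obtain ⟨m', rfl, hm'⟩ := coeff_rename_ne_zero _ p m hm
    rw [← hp hm', Finsupp.weight_apply, Finsupp.weight_apply]
    exact Finsupp.sum_mapDomain_index (fun _ => zero_smul _ _) (fun _ _ _ => add_smul _ _ _)

/-- `M` is graded by the vector degree: it is the direct sum of its homogeneous components (which
are always independent of each other), that is, it is spanned by them. -/
def IsGradedByDegree {r n : ℕ} (M : Subrepresentation (diagAction r n)) : Prop :=
  ⨆ d, (M ⊓ homogeneousPart r n d).toSubmodule = M.toSubmodule

/-- The graded Frobenius characteristic `∑_d q^d M_d(w)`, a series in `q = q_1, …, q_r` with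
coefficients in `Λ`. -/
def gradedFrob {r n : ℕ} (M : Subrepresentation (diagAction r n)) :
    MvPowerSeries (Fin r) SymmFun :=
  fun d => frobChar (M ⊓ homogeneousPart r n d).toRepresentation

/-- The operator `∂p_1`, extended coefficientwise to series in `q`. -/
def dp1Series {r : ℕ} (F : MvPowerSeries (Fin r) SymmFun) : MvPowerSeries (Fin r) SymmFun :=
  fun d => dp1 (MvPowerSeries.coeff d F)

/-- The elementary symmetric polynomial `e_k` in `n` variables. -/
def elem (n k : ℕ) : symmetricSubalgebra (Fin n) ℚ :=
  ⟨esymm (Fin n) ℚ k, (mem_symmetricSubalgebra _).mpr (esymm_isSymmetric (Fin n) ℚ k)⟩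

/-- The inclusion of `S_n` in `S_{n+1}`, as the permutations of the first `n` indices. -/
def permSucc (n : ℕ) : Equiv.Perm (Fin n) →* Equiv.Perm (Fin (n + 1)) :=
  Equiv.Perm.viaEmbeddingHom Fin.castSuccEmb

end DiagonalModules

end

/-! The isomorphism consists in setting the last variable of each set to zero; its inverse is the
substitution `u_i ↦ u_i - u_{n+1}`.

Injectivity is translation invariance. The Vandermonde determinant is killed by every polarized
power sum `∑ i, ∂_{w_i} ∂_{w'_i} ⋯` of positive order (`vandermondeX_mem_harmonics`), and the space
of such polynomials is stable under derivatives and under the `E_{uv}^{(k)}`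
(`isClosedUnderOps_harmonics`). All of `Diag[n+1]` is therefore killed by each `∑ i, ∂_{u_i}`, so
its elements depend only on the differences `u_i - u_{n+1}` and are recovered from their values at
`u_{n+1} = 0` (`subLast_setLastZero`).

The image is `Diag[n;n]` (`map_setLastZero_opSpan`): the specialization sends `Δ_{n+1}` to `± e_n
Δ_n` and commutes with the `E_{uv}^{(k)}` and with `∂_{u_i}` for `i ≤ n`, while on `Diag[n+1]` the
derivative `∂_{u_{n+1}}` is minus the sum of the others. Both substitutions preserve the vector
degree, and the inverse one is visibly `S_n`-equivariant.

The Frobenius identity then reduces to the fact that `∂p_1` is the counterpart of restriction from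
`S_{n+1}` to `S_n` (`dp1_frobChar`), applied degree by degree. -/

noncomputable section

namespace DiagonalModules

open MvPolynomial

/-! ### Spans closed under the operators, and commutators of derivatives with `E_{uv}^{(k)}` -/

section OpSpan

variable {r n : ℕ}

theorem mem_opSpan_self (p : Poly r n) : p ∈ opSpan p :=
  Submodule.mem_sInf.mpr fun _ hW => hW.1

theorem opSpan_le {p : Poly r n} {W : Submodule ℚ (Poly r n)} (hp : p ∈ W)
    (hW : IsClosedUnderOps W) : opSpan p ≤ W :=
  sInf_le ⟨hp, hW⟩

theorem isClosedUnderOps_opSpan (p : Poly r n) : IsClosedUnderOps (opSpan p) where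
  pderiv_mem u i f hf := Submodule.mem_sInf.mpr fun W hW =>
    hW.2.pderiv_mem u i f (Submodule.mem_sInf.mp hf W hW)
  opE_mem u v huv k hk f hf := Submodule.mem_sInf.mpr fun W hW =>
    hW.2.opE_mem u v huv k hk f (Submodule.mem_sInf.mp hf W hW)

theorem opE_apply (u v : Fin r) (k : ℕ) (f : Poly r n) :
    opE u v k f = ∑ i, X (u, i) * (pderiv (v, i))^[k] f := by
  simp only [opE, LinearMap.sum_apply, LinearMap.comp_apply, LinearMap.mulLeft_apply]
  refine Finset.sum_congr rfl fun i _ => ?_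
  rw [Module.End.pow_apply]
  rfl

theorem pderiv_comm {σ : Type*} (i j : σ) (f : MvPolynomial σ ℚ) :
    pderiv i (pderiv j f) = pderiv j (pderiv i f) := by
  classical
  ext m
  simp only [coeff_pderiv]
  by_cases h : i = j
  · rw [h]
  · rw [add_right_comm]
    simp [h, Ne.symm h]
    ring

theorem iterate_pderiv_comm {σ : Type*} (i j : σ) (k : ℕ) (f : MvPolynomial σ ℚ) :
    pderiv i ((pderiv j)^[k] f) = (pderiv j)^[k] (pderiv i f) :=
  (Function.Commute.iterate_right (f := pderiv i) (g := pderiv j)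
    (fun g => pderiv_comm i j g) k).eq f

/-- Derivatives commute with each other, so the commutator comes only from differentiating the
factor `u_i`. -/
theorem pderiv_opE (w u v : Fin r) (i : Fin n) (k : ℕ) (f : Poly r n) :
    pderiv (w, i) (opE u v k f) =
      opE u v k (pderiv (w, i) f) + if u = w then (pderiv (v, i))^[k] f else 0 := by
  classical
  simp only [opE_apply, map_sum, pderiv_mul, pderiv_X, iterate_pderiv_comm, Finset.sum_add_distrib]
  rw [add_comm]
  congr 1
  split_ifs with h
  · subst h
    rw [Finset.sum_eq_single i]
    · simp
    · intro b _ hb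
      simp [hb]
    · simp
  · refine Finset.sum_eq_zero fun b _ => ?_
    simp [h]

end OpSpan

/-! ### Polynomials killed by the polarized power sums of derivatives -/

section PolarizedPowerSums

variable {r n : ℕ}

/-- The composite of the partial derivatives with respect to `w_i`, for `w` in the list `l`. -/
def derivList (l : List (Fin r)) (i : Fin n) : Module.End ℚ (Poly r n) :=
  l.foldl (fun D w => (pderiv (w, i)).toLinearMap ∘ₗ D) LinearMap.id

theorem derivList_nil (i : Fin n) (f : Poly r n) : derivList [] i f = f := rfl

theorem derivList_concat (l : List (Fin r)) (w : Fin r) (i : Fin n) (f : Poly r n) :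
    derivList (l ++ [w]) i f = pderiv (w, i) (derivList l i f) := by
  simp [derivList]

theorem derivList_append (l l' : List (Fin r)) (i : Fin n) (f : Poly r n) :
    derivList (l ++ l') i f = derivList l' i (derivList l i f) := by
  induction l' using List.reverseRecOn with
  | nil => simp [derivList_nil]
  | append_singleton l' w ih => rw [← List.append_assoc, derivList_concat, ih, derivList_concat]

theorem derivList_cons (l : List (Fin r)) (w : Fin r) (i : Fin n) (f : Poly r n) :
    derivList (w :: l) i f = derivList l i (pderiv (w, i) f) :=
  derivList_append [w] l i f

theorem derivList_replicate (v : Fin r) (k : ℕ) (i : Fin n) (f : Poly r n) :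
    derivList (List.replicate k v) i f = (pderiv (v, i))^[k] f := by
  induction k generalizing f with
  | zero => rfl
  | succ k ih => rw [List.replicate_succ, derivList_cons, ih, Function.iterate_succ_apply]

theorem derivList_pderiv (l : List (Fin r)) (w : Fin r) (i j : Fin n) (f : Poly r n) :
    derivList l i (pderiv (w, j) f) = pderiv (w, j) (derivList l i f) := by
  induction l generalizing f with
  | nil => rfl
  | cons v l ih => rw [derivList_cons, derivList_cons, pderiv_comm, ih]

/-- The polynomials killed by all polarized power sums
`∑ i, ∂_{w_i} ∂_{w'_i} ⋯` of positive degree in the derivatives. -/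
def harmonics (r n : ℕ) : Submodule ℚ (Poly r n) :=
  ⨅ (l : List (Fin r)) (_ : l ≠ []), LinearMap.ker (∑ i : Fin n, derivList l i)

theorem mem_harmonics {f : Poly r n} :
    f ∈ harmonics r n ↔ ∀ l : List (Fin r), l ≠ [] → ∑ i, derivList l i f = 0 := by
  simp [harmonics, Submodule.mem_iInf]

/-- The derivatives in `l` are moved one at a time through `E_{uv}^{(k)}`; `l'` records those
already inside. Each commutator replaces the derivative being moved by `∂_v^k`, so it contributes
another polarized power sum applied to `f`. -/
theorem sum_derivList_opE {f : Poly r n} (hf : f ∈ harmonics r n) (u v : Fin r) {k : ℕ}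
    (hk : 1 ≤ k) (l l' : List (Fin r)) (hl : l' ++ l ≠ []) :
    ∑ i, derivList l i (opE u v k (derivList l' i f)) = 0 := by
  induction l generalizing l' with
  | nil =>
    simp only [derivList_nil]
    rw [← map_sum, mem_harmonics.mp hf l' (by simpa using hl), map_zero]
  | cons w l ih =>
    simp only [derivList_cons, pderiv_opE, map_add, Finset.sum_add_distrib, ← derivList_concat]
    rw [ih (l' ++ [w]) (by simp), zero_add]
    split_ifs with h
    · simp only [← derivList_replicate, ← derivList_append]
      -- The list `l' ++ replicate k v ++ l` is nonempty even when `l'` and `l` are empty, because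
      -- `k ≥ 1`.
      exact mem_harmonics.mp hf _ (by simp; omega)
    · simp

theorem isClosedUnderOps_harmonics : IsClosedUnderOps (harmonics r n) where
  pderiv_mem u i f hf := mem_harmonics.mpr fun l hl => by
    simp only [derivList_pderiv]
    rw [← map_sum, mem_harmonics.mp hf l hl, map_zero]
  opE_mem u v _ k hk f hf := mem_harmonics.mpr fun l hl =>
    sum_derivList_opE hf u v hk l [] (by simpa using hl)

end PolarizedPowerSums

/-! ### The Vandermonde determinant is harmonic -/

section Vandermonde

theorem derivation_det_eq_zero {A ι : Type*} [CommRing A] [Algebra ℚ A] [Fintype ι] [DecidableEq ι]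
    (D : Derivation ℚ A A) (M : Matrix ι ι A) (h : ∀ i j, D (M i j) = 0) : D M.det = 0 := by
  have hp : ∀ (s : Finset ι) (σ : Equiv.Perm ι), D (∏ i ∈ s, M (σ i) i) = 0 := by
    intro s σ
    induction s using Finset.induction_on with
    | empty => simp
    | insert a s ha ih => simp [Finset.prod_insert ha, h, ih]
  rw [Matrix.det_apply, map_sum]
  refine Finset.sum_eq_zero fun σ _ => ?_
  rw [Units.smul_def, map_zsmul, hp, smul_zero]

theorem det_updateRow_eq_sum {A ι : Type*} [CommRing A] [Fintype ι] [DecidableEq ι]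
    (M : Matrix ι ι A) (i : ι) (b : ι → A) :
    (M.updateRow i b).det = ∑ l, b l * M.adjugate l i := by
  rw [← Matrix.cramer_transpose_apply, Matrix.cramer_eq_adjugate_mulVec,
    ← Matrix.adjugate_transpose, Matrix.mulVec_transpose]
  rfl

/-- The sum over the rows of the determinants in which one row of `M` is replaced by the same row
of `M * N`. -/
theorem sum_det_updateRow_mul {A ι : Type*} [CommRing A] [Fintype ι] [DecidableEq ι]
    (M N : Matrix ι ι A) :
    ∑ i, (M.updateRow i ((M * N) i)).det = M.det * N.trace := by
  -- By expansion along row `i`, the sum becomes the trace of `M * N * M.adjugate`, and cyclicity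
  -- brings `M.adjugate * M = det M` together.
  have h : ∀ i, (M.updateRow i ((M * N) i)).det = (M * N * M.adjugate) i i := fun i =>
    det_updateRow_eq_sum M i _
  simp only [h]
  change Matrix.trace (M * N * M.adjugate) = _
  rw [Matrix.trace_mul_comm, ← mul_assoc, Matrix.adjugate_mul, smul_mul_assoc, one_mul,
    Matrix.trace_smul, smul_eq_mul]

theorem iterate_derivation_mul {A : Type*} [CommRing A] [Algebra ℚ A] (D : Derivation ℚ A A)
    (k : ℕ) (a c : A) (hc : D c = 0) : D^[k] (a * c) = D^[k] a * c := by
  induction k generalizing a with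
  | zero => rfl
  | succ k ih =>
    rw [Function.iterate_succ_apply, Function.iterate_succ_apply, D.leibniz, hc, smul_zero,
      zero_add, smul_eq_mul, mul_comm, ih]

/-- In the expansion along row `i` the cofactors involve only the other rows, so they are constants
for `D`. -/
theorem iterate_derivation_det {A ι : Type*} [CommRing A] [Algebra ℚ A] [Fintype ι]
    [DecidableEq ι] (D : Derivation ℚ A A) (k : ℕ) (M : Matrix ι ι A) (i : ι)
    (h : ∀ j, j ≠ i → ∀ l, D (M j l) = 0) :
    D^[k] M.det = (M.updateRow i fun l => D^[k] (M i l)).det := by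
  have h0 := det_updateRow_eq_sum M i (M i)
  rw [Matrix.updateRow_eq_self] at h0
  have hlin : ∀ s : ι → A, D^[k] (∑ l, s l) = ∑ l, D^[k] (s l) := by
    intro s
    have := map_sum ((D.toLinearMap : Module.End ℚ A) ^ k) s Finset.univ
    simp only [Module.End.pow_apply] at this
    exact this
  rw [h0, det_updateRow_eq_sum, hlin]
  refine Finset.sum_congr rfl fun l _ => ?_
  rw [Matrix.adjugate_apply]
  refine iterate_derivation_mul D k _ _ (derivation_det_eq_zero D _ fun j m => ?_)
  by_cases hj : j = i
  · subst hj
    by_cases hm : m = l <;> simp [hm]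
  · simp [Matrix.updateRow_ne hj, h j hj]

variable {r n : ℕ} [NeZero r]

theorem iterate_pderiv_X_pow {σ : Type*} (i : σ) (k m : ℕ) :
    (pderiv i)^[k] (X i ^ m : MvPolynomial σ ℚ) = (m.descFactorial k : ℚ) • X i ^ (m - k) := by
  induction k with
  | zero => simp
  | succ k ih =>
    rw [Function.iterate_succ_apply', ih, Derivation.map_smul, pderiv_pow, pderiv_X_self, mul_one,
      Nat.descFactorial_succ, Nat.sub_sub, mul_comm (m - k), Nat.cast_mul, mul_smul]
    simp [smul_eq_C_mul]

theorem sum_iterate_pderiv_vandermondeX {k : ℕ} (hk : 1 ≤ k) :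
    ∑ i, (pderiv ((0 : Fin r), i))^[k] (vandermondeX r n) = 0 := by
  classical
  -- `N` is the matrix of the `k`-th derivative on the monomials `1, x, …, x^{n-1}`: right
  -- multiplication by `N` differentiates each Vandermonde row `k` times. As `k ≥ 1`, it is strictly
  -- triangular and has trace zero.
  let N : Matrix (Fin n) (Fin n) (Poly r n) := fun a b =>
    if (a : ℕ) + k = b then ((b : ℕ).descFactorial k : Poly r n) else 0
  have hN : N.trace = 0 := Finset.sum_eq_zero fun i _ => if_neg (by omega)
  have h := sum_det_updateRow_mul (Matrix.vandermonde fun i : Fin n => (X (0, i) : Poly r n)) N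
  rw [hN, mul_zero] at h
  rw [← h]
  refine Finset.sum_congr rfl fun i _ => ?_
  rw [vandermondeX, iterate_derivation_det _ _ _ i]
  · congr 2
    ext1 b
    rw [Matrix.vandermonde_apply, iterate_pderiv_X_pow, Matrix.mul_apply]
    simp only [N, Matrix.vandermonde_apply, mul_ite, mul_zero]
    by_cases hb : k ≤ b
    · rw [Finset.sum_eq_single ⟨b - k, by omega⟩]
      · rw [if_pos (by simp; omega), smul_eq_C_mul, mul_comm]
        simp
      · intro a _ ha
        exact if_neg fun h => ha (Fin.ext (by simp; omega))
      · simp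
    · rw [Finset.sum_eq_zero, Nat.descFactorial_eq_zero_iff_lt.mpr (by omega)]
      · simp
      · intro a _
        exact if_neg (by omega)
  · intro j hj l
    rw [Matrix.vandermonde_apply, pderiv_pow, pderiv_X_of_ne (by simpa using hj), mul_zero]

theorem pderiv_vandermondeX_of_ne {u : Fin r} (hu : u ≠ 0) (i : Fin n) :
    pderiv (u, i) (vandermondeX r n) = 0 :=
  derivation_det_eq_zero _ _ fun j l => by
    rw [Matrix.vandermonde_apply, pderiv_pow, pderiv_X_of_ne (by simp [hu.symm]), mul_zero]

theorem vandermondeX_mem_harmonics : vandermondeX r n ∈ harmonics r n := by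
  refine mem_harmonics.mpr fun l hl => ?_
  -- Either all derivatives are in `x`, giving an ordinary power sum, or some derivative in another
  -- set kills the determinant.
  by_cases h : ∀ u ∈ l, u = 0
  · rw [List.eq_replicate_of_mem h]
    simp only [derivList_replicate]
    exact sum_iterate_pderiv_vandermondeX (List.length_pos_of_ne_nil hl)
  · push Not at h
    obtain ⟨u, hul, hu⟩ := h
    obtain ⟨s, t, rfl⟩ := List.append_of_mem hul
    refine Finset.sum_eq_zero fun i _ => ?_
    have h1 : derivList s i (pderiv (u, i) (vandermondeX r n)) = 0 := by
      rw [pderiv_vandermondeX_of_ne hu, map_zero]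
    rw [derivList_append, derivList_cons, ← derivList_pderiv, h1, map_zero]

end Vandermonde

/-! ### Specializing the last variables to zero, and translation invariance -/

section LastVariables

variable {r n : ℕ}

/-- Setting the last variable of each set to zero. -/
def setLastZero (r n : ℕ) : Poly r (n + 1) →ₐ[ℚ] Poly r n :=
  aeval fun p => Fin.lastCases (motive := fun _ => Poly r n) 0 (fun i => X (p.1, i)) p.2

/-- Replacing `u_i` by `u_i - u_{n+1}`. -/
def subLast (r n : ℕ) : Poly r n →ₐ[ℚ] Poly r (n + 1) :=
  aeval fun p => X (p.1, p.2.castSucc) - X (p.1, Fin.last n)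

@[simp]
theorem setLastZero_X_castSucc (u : Fin r) (i : Fin n) :
    setLastZero r n (X (u, i.castSucc)) = X (u, i) := by
  simp [setLastZero]

@[simp]
theorem setLastZero_X_last (u : Fin r) : setLastZero r n (X (u, Fin.last n)) = 0 := by
  simp [setLastZero]

@[simp]
theorem subLast_X (u : Fin r) (i : Fin n) :
    subLast r n (X (u, i)) = X (u, i.castSucc) - X (u, Fin.last n) := by
  simp [subLast]

@[simp]
theorem setLastZero_subLast (f : Poly r n) : setLastZero r n (subLast r n f) = f := by
  have h : (setLastZero r n).comp (subLast r n) = AlgHom.id ℚ _ := by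
    ext ⟨u, i⟩ : 1
    simp
  exact DFunLike.congr_fun h f

theorem derivation_intertwine {σ B : Type*} [CommRing B] [Algebra ℚ B]
    (φ : MvPolynomial σ ℚ →ₐ[ℚ] B) (D : Derivation ℚ (MvPolynomial σ ℚ) (MvPolynomial σ ℚ))
    (D' : Derivation ℚ B B) (h : ∀ x, φ (D (X x)) = D' (φ (X x))) (f : MvPolynomial σ ℚ) :
    φ (D f) = D' (φ f) := by
  induction f using MvPolynomial.induction_on with
  | C a => simp [← algebraMap_eq]
  | add p q hp hq => simp [hp, hq]
  | mul_X p x hp => simp [Derivation.leibniz, hp, h]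

theorem notMem_vars_of_pderiv_eq_zero {σ : Type*} {i : σ} {f : MvPolynomial σ ℚ}
    (h : pderiv i f = 0) : i ∉ f.vars := by
  classical
  intro hi
  obtain ⟨m, hm, him⟩ := (mem_vars_iff_mem_support i).mp hi
  have h1 := congrArg (coeff (m - Finsupp.single i 1)) h
  rw [coeff_pderiv, tsub_add_cancel_of_le (Finsupp.single_le_iff.mpr
    (Nat.one_le_iff_ne_zero.mpr (Finsupp.mem_support_iff.mp him))), coeff_zero] at h1
  rcases mul_eq_zero.mp h1 with h2 | h2
  · exact mem_support_iff.mp hm h2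
  · exact absurd h2 (by positivity)

theorem setLastZero_pderiv_castSucc (u : Fin r) (i : Fin n) (f : Poly r (n + 1)) :
    setLastZero r n (pderiv (u, i.castSucc) f) = pderiv (u, i) (setLastZero r n f) := by
  classical
  refine derivation_intertwine _ _ _ ?_ f
  rintro ⟨v, j⟩
  induction j using Fin.lastCases with
  | last =>
    rw [setLastZero_X_last, pderiv_X_of_ne (by simp [Fin.ext_iff]; omega), map_zero, map_zero]
  | cast j =>
    rw [setLastZero_X_castSucc, pderiv_X, pderiv_X]
    by_cases h : (u, i) = (v, j)
    · obtain ⟨rfl, rfl⟩ := Prod.mk.inj h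
      simp
    · have h' : (u, i.castSucc) ≠ (v, j.castSucc) := by simpa using h
      rw [Pi.single_eq_of_ne (Ne.symm h), Pi.single_eq_of_ne (Ne.symm h'), map_zero]

/-- The summand of index `n + 1` carries the factor `u_{n+1}`, which is sent to zero. -/
theorem setLastZero_opE (u v : Fin r) (k : ℕ) (f : Poly r (n + 1)) :
    setLastZero r n (opE u v k f) = opE u v k (setLastZero r n f) := by
  have h : ∀ (i : Fin n), setLastZero r n ((pderiv (v, i.castSucc))^[k] f) =
      (pderiv (v, i))^[k] (setLastZero r n f) := fun i =>
    (Function.Semiconj.iterate_right (f := setLastZero r n) (ga := pderiv (v, i.castSucc))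
      (gb := pderiv (v, i)) (fun g => setLastZero_pderiv_castSucc v i g) k).eq f
  simp [opE_apply, Fin.sum_univ_castSucc, h]

theorem subLast_setLastZero {f : Poly r (n + 1)}
    (hf : ∀ u, ∑ i, pderiv (u, i) f = 0) : subLast r n (setLastZero r n f) = f := by
  classical
  -- The change of variables `α` turns `∑ i, ∂_{u_i}` into `∂_{u_{n+1}}`, so `α f` does not involve
  -- the last variables. On such polynomials `β`, the inverse of `α`, agrees with `subLast ∘
  -- setLastZero`; moreover `setLastZero ∘ α = setLastZero`.
  let α : Poly r (n + 1) →ₐ[ℚ] Poly r (n + 1) :=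
    aeval fun p => if p.2 = Fin.last n then X p else X p + X (p.1, Fin.last n)
  let β : Poly r (n + 1) →ₐ[ℚ] Poly r (n + 1) :=
    aeval fun p => if p.2 = Fin.last n then X p else X p - X (p.1, Fin.last n)
  have hβα : β.comp α = AlgHom.id ℚ _ := by
    ext ⟨u, i⟩ : 1
    by_cases h : i = Fin.last n <;> simp [α, β, h]
  have hder : ∀ u, pderiv (u, Fin.last n) (α f) = 0 := by
    intro u
    have := derivation_intertwine α (∑ i, pderiv (u, i)) (pderiv (u, Fin.last n)) ?_ f
    · rw [← this, ← Derivation.coeFnAddMonoidHom_apply, map_sum, Finset.sum_apply]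
      simp [hf]
    · rintro ⟨v, j⟩
      rw [← Derivation.coeFnAddMonoidHom_apply, map_sum, Finset.sum_apply]
      simp only [Derivation.coeFnAddMonoidHom_apply, pderiv_X, Pi.single_apply]
      by_cases huv : v = u
      · subst huv
        by_cases h : j = Fin.last n <;> simp [α, h, pderiv_X]
      · by_cases h : j = Fin.last n <;> simp [α, h, pderiv_X, huv]
  have key : ((subLast r n).comp (setLastZero r n)) (α f) = β (α f) := by
    refine hom_congr_vars (f₁ := ((subLast r n).comp (setLastZero r n)).toRingHom)
      (f₂ := β.toRingHom) ?_ ?_ rfl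
    · ext a
      simp
    · rintro ⟨u, j⟩ hj _
      induction j using Fin.lastCases with
      | last => exact absurd hj (notMem_vars_of_pderiv_eq_zero (hder u))
      | cast j =>
        have : j.castSucc ≠ Fin.last n := (Fin.castSucc_lt_last j).ne
        simp [β, this]
  have hρα : (setLastZero r n).comp α = setLastZero r n := by
    ext ⟨u, i⟩ : 1
    by_cases h : i = Fin.last n <;> simp [α, h]
  rw [AlgHom.comp_apply, ← AlgHom.comp_apply (setLastZero r n) α, hρα, ← AlgHom.comp_apply β α,
    hβα] at key
  exact key

theorem sum_pderiv_of_mem_harmonics {f : Poly r n} (hf : f ∈ harmonics r n) (u : Fin r) :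
    ∑ i, pderiv (u, i) f = 0 :=
  mem_harmonics.mp hf [u] (by simp)

variable [NeZero r]

theorem inX_esymm : inX (esymm (Fin n) ℚ n) = ∏ i, (X (0, i) : Poly r n) := by
  have h : Finset.powersetCard n (Finset.univ : Finset (Fin n)) = {Finset.univ} := by
    have := Finset.powersetCard_self (Finset.univ : Finset (Fin n))
    rwa [Finset.card_univ, Fintype.card_fin] at this
  simp [esymm, inX, h]

/-- In `∏_{i<j} (x_j - x_i)`, the `n` factors with `j = n + 1` become `-x_i`, which yields `e_n` and
the sign. -/
theorem setLastZero_vandermondeX :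
    setLastZero r n (vandermondeX r (n + 1)) =
      (-1) ^ n * (inX (esymm (Fin n) ℚ n) * vandermondeX r n) := by
  have h : ∀ i : Fin n, ∏ j ∈ Finset.Ioi i.castSucc,
      (setLastZero r n (X (0, j)) - X (0, i) : Poly r n) =
      -X (0, i) * ∏ j ∈ Finset.Ioi i, (X (0, j) - X (0, i)) := by
    intro i
    have hI : Finset.Ioi i.castSucc =
        insert (Fin.last n) ((Finset.Ioi i).map Fin.castSuccEmb) := by
      ext j
      induction j using Fin.lastCases with
      | last => simp [Fin.castSucc_lt_last]
      | cast j => simpa using fun _ => (Fin.castSucc_lt_last j).le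
    rw [hI, Finset.prod_insert (by simp), Finset.prod_map]
    simp
  rw [inX_esymm, vandermondeX, vandermondeX, Matrix.det_vandermonde, Matrix.det_vandermonde,
    Fin.prod_univ_castSucc, ← Fin.top_eq_last, Finset.Ioi_top]
  simp only [map_mul, map_prod, map_sub, setLastZero_X_castSucc, h, Finset.prod_mul_distrib]
  rw [Finset.prod_neg]
  simp
  ring

theorem opSpan_vandermondeX_le_harmonics :
    opSpan (vandermondeX r n) ≤ harmonics r n :=
  opSpan_le vandermondeX_mem_harmonics isClosedUnderOps_harmonics

theorem map_setLastZero_opSpan :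
    (opSpan (vandermondeX r (n + 1))).map (setLastZero r n).toLinearMap =
      opSpan (inX (esymm (Fin n) ℚ n) * vandermondeX r n) := by
  have hL := isClosedUnderOps_opSpan (vandermondeX r (n + 1))
  have hL' := isClosedUnderOps_opSpan (inX (esymm (Fin n) ℚ n) * vandermondeX r n)
  have hlast : ∀ (u : Fin r), ∀ f ∈ opSpan (vandermondeX r (n + 1)),
      pderiv (u, Fin.last n) f = -∑ i : Fin n, pderiv (u, i.castSucc) f := by
    intro u f hf
    have := sum_pderiv_of_mem_harmonics (opSpan_vandermondeX_le_harmonics hf) u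
    rw [Fin.sum_univ_castSucc] at this
    exact eq_neg_of_add_eq_zero_right this
  refine le_antisymm ?_ ?_
  -- The intersection with the span itself keeps `hlast` available for the last derivative while
  -- closure is being checked.
  · have h : opSpan (vandermondeX r (n + 1)) ≤ opSpan (vandermondeX r (n + 1)) ⊓
        (opSpan (inX (esymm (Fin n) ℚ n) * vandermondeX r n)).comap
          (setLastZero r n).toLinearMap := by
      refine opSpan_le ⟨mem_opSpan_self _, ?_⟩ ⟨?_, ?_⟩
      · change setLastZero r n _ ∈ opSpan _
        rw [setLastZero_vandermondeX]
        rcases neg_one_pow_eq_or (Poly r n) n with h | h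
        · simpa [h] using mem_opSpan_self _
        · simpa [h] using mem_opSpan_self _
      · rintro u i f ⟨hf, hf'⟩
        refine ⟨hL.pderiv_mem u i f hf, ?_⟩
        change setLastZero r n _ ∈ opSpan _
        induction i using Fin.lastCases with
        | last =>
          rw [hlast u f hf, map_neg, map_sum]
          refine neg_mem (sum_mem fun i _ => ?_)
          rw [setLastZero_pderiv_castSucc]
          exact hL'.pderiv_mem u i _ hf'
        | cast i =>
          rw [setLastZero_pderiv_castSucc]
          exact hL'.pderiv_mem u i _ hf'
      · rintro u v huv k hk f ⟨hf, hf'⟩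
        refine ⟨hL.opE_mem u v huv k hk f hf, ?_⟩
        change setLastZero r n _ ∈ opSpan _
        rw [setLastZero_opE]
        exact hL'.opE_mem u v huv k hk _ hf'
    exact Submodule.map_le_iff_le_comap.mpr (h.trans inf_le_right)
  · refine opSpan_le ?_ ⟨?_, ?_⟩
    · refine ⟨(-1) ^ n * vandermondeX r (n + 1), ?_, ?_⟩
      · rcases neg_one_pow_eq_or (Poly r (n + 1)) n with h | h
        · simpa [h] using mem_opSpan_self _
        · simpa [h] using mem_opSpan_self _
      · change setLastZero r n _ = _
        rw [map_mul, setLastZero_vandermondeX, ← mul_assoc]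
        simp [← mul_pow]
    · rintro u i _ ⟨f, hf, rfl⟩
      exact ⟨_, hL.pderiv_mem u i.castSucc f hf, setLastZero_pderiv_castSucc u i f⟩
    · rintro u v huv k hk _ ⟨f, hf, rfl⟩
      exact ⟨_, hL.opE_mem u v huv k hk f hf, setLastZero_opE u v k f⟩

end LastVariables

/-! ### Homogeneity for the vector degree -/

section Grading

variable {r n : ℕ}

theorem mem_homogeneousPart {d : Fin r →₀ ℕ} {f : Poly r n} :
    f ∈ homogeneousPart r n d ↔
      IsWeightedHomogeneous (fun p : Fin r × Fin n => (Finsupp.single p.1 1 : Fin r →₀ ℕ)) f d :=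
  Iff.rfl

theorem X_mem_homogeneousPart (u : Fin r) (i : Fin n) :
    (X (u, i) : Poly r n) ∈ homogeneousPart r n (Finsupp.single u 1) :=
  mem_homogeneousPart.mpr (isWeightedHomogeneous_X ℚ _ (u, i))

/-- Truncated subtraction is harmless: when `d u = 0` the derivative vanishes, and zero is
homogeneous of every degree. -/
theorem pderiv_mem_homogeneousPart {d : Fin r →₀ ℕ} {f : Poly r n}
    (hf : f ∈ homogeneousPart r n d) (u : Fin r) (i : Fin n) :
    pderiv (u, i) f ∈ homogeneousPart r n (d - Finsupp.single u 1) := by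
  classical
  intro m hm
  rw [coeff_pderiv] at hm
  rw [← mem_homogeneousPart.mp hf (left_ne_zero_of_mul hm)]
  simp [Finsupp.weight_single]

theorem iterate_pderiv_mem_homogeneousPart {d : Fin r →₀ ℕ} {f : Poly r n}
    (hf : f ∈ homogeneousPart r n d) (u : Fin r) (i : Fin n) (k : ℕ) :
    (pderiv (u, i))^[k] f ∈ homogeneousPart r n (d - k • Finsupp.single u 1) := by
  induction k with
  | zero => simpa using hf
  | succ k ih =>
    rw [Function.iterate_succ_apply', succ_nsmul, ← tsub_tsub]
    exact pderiv_mem_homogeneousPart ih u i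

theorem opE_mem_homogeneousPart {d : Fin r →₀ ℕ} {f : Poly r n}
    (hf : f ∈ homogeneousPart r n d) (u v : Fin r) (k : ℕ) :
    opE u v k f ∈
      homogeneousPart r n (Finsupp.single u 1 + (d - k • Finsupp.single v 1)) := by
  rw [opE_apply]
  exact mem_homogeneousPart.mpr (IsWeightedHomogeneous.sum _ _ _ fun i _ =>
    (mem_homogeneousPart.mp (X_mem_homogeneousPart u i)).mul
      (mem_homogeneousPart.mp (iterate_pderiv_mem_homogeneousPart hf v i k)))

theorem aeval_mem_homogeneousPart {m : ℕ} {g : Fin r × Fin n → Poly r m}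
    (hg : ∀ p, g p ∈ homogeneousPart r m (Finsupp.single p.1 1)) {d : Fin r →₀ ℕ} {f : Poly r n}
    (hf : f ∈ homogeneousPart r n d) : aeval g f ∈ homogeneousPart r m d := by
  rw [aeval_def, eval₂_eq]
  refine mem_homogeneousPart.mpr (IsWeightedHomogeneous.sum _ _ _ fun s hs => ?_)
  refine IsWeightedHomogeneous.C_mul ?_ _
  rw [← mem_homogeneousPart.mp hf (mem_support_iff.mp hs), Finsupp.weight_apply]
  exact IsWeightedHomogeneous.prod _ _ _ fun p _ => (mem_homogeneousPart.mp (hg p)).pow _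

theorem setLastZero_mem_homogeneousPart {d : Fin r →₀ ℕ} {f : Poly r (n + 1)}
    (hf : f ∈ homogeneousPart r (n + 1) d) : setLastZero r n f ∈ homogeneousPart r n d := by
  refine aeval_mem_homogeneousPart ?_ hf
  rintro ⟨u, i⟩
  induction i using Fin.lastCases with
  | last => 
    simpa using mem_homogeneousPart.mpr (isWeightedHomogeneous_zero ℚ _ (Finsupp.single u 1))
  | cast i => simpa using X_mem_homogeneousPart u i

theorem subLast_mem_homogeneousPart {d : Fin r →₀ ℕ} {f : Poly r n}
    (hf : f ∈ homogeneousPart r n d) : subLast r n f ∈ homogeneousPart r (n + 1) d :=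
  aeval_mem_homogeneousPart (fun p => (homogeneousPart r (n + 1) _).toSubmodule.sub_mem
    (X_mem_homogeneousPart p.1 _) (X_mem_homogeneousPart p.1 _)) hf

/-- Every operator sends homogeneous elements to homogeneous ones, so the sum of the components is
closed and contains `p`; minimality of the span concludes. -/
theorem iSup_opSpan_inf_homogeneousPart {p : Poly r n} {d : Fin r →₀ ℕ}
    (hp : p ∈ homogeneousPart r n d) :
    ⨆ e, opSpan p ⊓ (homogeneousPart r n e).toSubmodule = opSpan p := by
  have hL := isClosedUnderOps_opSpan p
  refine le_antisymm (iSup_le fun e => inf_le_left) (opSpan_le ?_ ⟨?_, ?_⟩)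
  · exact Submodule.mem_iSup_of_mem d ⟨mem_opSpan_self p, hp⟩
  · intro u i f hf
    refine (iSup_le fun e => ?_ : _ ≤ Submodule.comap (pderiv (u, i)).toLinearMap
      (⨆ e, opSpan p ⊓ (homogeneousPart r n e).toSubmodule)) hf
    rintro g ⟨hg, hg'⟩
    exact Submodule.mem_iSup_of_mem _
      ⟨hL.pderiv_mem u i g hg, pderiv_mem_homogeneousPart hg' u i⟩
  · intro u v huv k hk f hf
    refine (iSup_le fun e => ?_ : _ ≤ Submodule.comap (opE u v k)
      (⨆ e, opSpan p ⊓ (homogeneousPart r n e).toSubmodule)) hf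
    rintro g ⟨hg, hg'⟩
    exact Submodule.mem_iSup_of_mem _
      ⟨hL.opE_mem u v huv k hk g hg, opE_mem_homogeneousPart hg' u v k⟩

variable [NeZero r]

theorem exists_vandermondeX_mem_homogeneousPart :
    ∃ d, vandermondeX r n ∈ homogeneousPart r n d := by
  rw [vandermondeX, Matrix.det_vandermonde]
  exact ⟨_, mem_homogeneousPart.mpr (IsWeightedHomogeneous.prod _ _ _ fun i _ =>
    IsWeightedHomogeneous.prod _ _ _ fun j _ =>
      (mem_homogeneousPart.mp (X_mem_homogeneousPart 0 j)).sub
        (mem_homogeneousPart.mp (X_mem_homogeneousPart 0 i)))⟩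

theorem exists_inX_esymm_mem_homogeneousPart :
    ∃ d, (inX (esymm (Fin n) ℚ n) : Poly r n) ∈ homogeneousPart r n d := by
  rw [inX_esymm]
  exact ⟨_, mem_homogeneousPart.mpr (IsWeightedHomogeneous.prod _ _ _ fun i _ =>
    mem_homogeneousPart.mp (X_mem_homogeneousPart 0 i))⟩

theorem Diag_one_toSubmodule : (Diag r n 1).toSubmodule = opSpan (vandermondeX r n) := by
  simp [Diag]

theorem isGradedByDegree_Diag_one : IsGradedByDegree (Diag r n 1) := by
  obtain ⟨d, hd⟩ := exists_vandermondeX_mem_homogeneousPart (r := r) (n := n)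
  simp only [IsGradedByDegree, Subrepresentation.toSubmodule_inf, Diag_one_toSubmodule]
  exact iSup_opSpan_inf_homogeneousPart hd

theorem isGradedByDegree_Diag_elem : IsGradedByDegree (Diag r n (elem n n)) := by
  obtain ⟨d, hd⟩ := exists_vandermondeX_mem_homogeneousPart (r := r) (n := n)
  obtain ⟨e, he⟩ := exists_inX_esymm_mem_homogeneousPart (r := r) (n := n)
  exact iSup_opSpan_inf_homogeneousPart
    (mem_homogeneousPart.mpr ((mem_homogeneousPart.mp he).mul (mem_homogeneousPart.mp hd)))

end Grading

/-! ### `∂p_1` and restriction from `S_{n+1}` to `S_n` -/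

section Frobenius

theorem powerSumEquiv_X (k : ℕ) : powerSumEquiv (X k) = psumSymm (k + 1) :=
  Subtype.ext ((AlgebraicIndependent.aevalEquiv_apply_coe algebraicIndependent_powerSum _).trans
    (aeval_X _ _))

theorem dp1_powerSumEquiv (P : MvPolynomial ℕ ℚ) :
    dp1 (powerSumEquiv P) = powerSumEquiv (pderiv 0 P) := by
  simp [dp1]

theorem powerSumEquiv_prod_X {s : Multiset ℕ} (hs : ∀ k ∈ s, 1 ≤ k) :
    powerSumEquiv (s.map fun k => (X (k - 1) : MvPolynomial ℕ ℚ)).prod =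
      (s.map psumSymm).prod := by
  rw [map_multiset_prod, Multiset.map_map]
  congr 1
  refine Multiset.map_congr rfl fun k hk => ?_
  rw [Function.comp_apply, powerSumEquiv_X, Nat.sub_add_cancel (hs k hk)]

theorem pderiv_zero_prod_X {s : Multiset ℕ} (hs : ∀ k ∈ s, 2 ≤ k) :
    pderiv 0 (s.map fun k => (X (k - 1) : MvPolynomial ℕ ℚ)).prod = 0 := by
  induction s using Multiset.induction_on with
  | empty => simp
  | cons a s ih =>
    have ha : 2 ≤ a := hs a (Multiset.mem_cons_self a s)
    rw [Multiset.map_cons, Multiset.prod_cons, pderiv_mul,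
      ih fun k hk => hs k (Multiset.mem_cons_of_mem hk), pderiv_X_of_ne (by omega)]
    simp

theorem dp1_prod_psumSymm {s : Multiset ℕ} (hs : ∀ k ∈ s, 2 ≤ k) (m : ℕ) :
    dp1 ((s + Multiset.replicate m 1).map psumSymm).prod =
      (m : ℚ) • ((s + Multiset.replicate (m - 1) 1).map psumSymm).prod := by
  have h : ∀ j, ∀ k ∈ s + Multiset.replicate j 1, 1 ≤ k := by
    intro j k hk
    rcases Multiset.mem_add.mp hk with hk | hk
    · exact (hs k hk).trans' (by norm_num)
    · exact (Multiset.eq_of_mem_replicate hk).ge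
  rw [← powerSumEquiv_prod_X (h m), ← powerSumEquiv_prod_X (h (m - 1)), dp1_powerSumEquiv,
    ← map_smul]
  congr 1
  simp only [Multiset.map_add, Multiset.prod_add, Multiset.map_replicate, Multiset.prod_replicate,
    pderiv_mul, pderiv_zero_prod_X hs, pderiv_pow, Nat.sub_self, pderiv_X_self, zero_mul, zero_add,
    mul_one, smul_eq_C_mul]
  simp
  ring

variable {n : ℕ}

@[simp]
theorem permSucc_castSucc (τ : Equiv.Perm (Fin n)) (i : Fin n) :
    permSucc n τ i.castSucc = (τ i).castSucc :=
  Equiv.Perm.viaEmbedding_apply τ Fin.castSuccEmb i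

@[simp]
theorem permSucc_last (τ : Equiv.Perm (Fin n)) : permSucc n τ (Fin.last n) = Fin.last n :=
  Equiv.Perm.viaEmbedding_apply_of_notMem τ Fin.castSuccEmb _
    (by rintro ⟨i, hi⟩; exact (Fin.castSucc_lt_last i).ne hi)

theorem cycleType_permSucc (τ : Equiv.Perm (Fin n)) : (permSucc n τ).cycleType = τ.cycleType := by
  classical
  rw [← Equiv.Perm.cycleType_extendDomain
    (Equiv.ofInjective _ (Fin.castSuccEmb (n := n)).injective) (g := τ)]
  congr 1
  ext1 x
  induction x using Fin.lastCases with
  | last =>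
    rw [permSucc_last, Equiv.Perm.extendDomain_apply_not_subtype]
    rintro ⟨i, hi⟩
    exact (Fin.castSucc_lt_last i).ne hi
  | cast i =>
    rw [permSucc_castSucc]
    exact (Equiv.Perm.extendDomain_apply_image τ
      (Equiv.ofInjective _ (Fin.castSuccEmb (n := n)).injective) i).symm

theorem exists_permSucc_eq {σ : Equiv.Perm (Fin (n + 1))} (hσ : σ (Fin.last n) = Fin.last n) :
    ∃ τ, permSucc n τ = σ := by
  have h : ∀ i : Fin n, σ i.castSucc ≠ Fin.last n := fun i hi =>
    (Fin.castSucc_lt_last i).ne (σ.injective (hi.trans hσ.symm))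
  let g : Fin n → Fin n := fun i => (σ i.castSucc).castPred (h i)
  have hg : Function.Injective g := fun i j hij => by
    have := congrArg Fin.castSucc hij
    simpa [g] using this
  refine ⟨Equiv.ofBijective g (Finite.injective_iff_bijective.mp hg), ?_⟩
  ext1 x
  induction x using Fin.lastCases with
  | last => rw [permSucc_last, hσ]
  | cast i => simp [g]

theorem sum_fixing_last {M : Type*} [AddCommMonoid M] (F : Equiv.Perm (Fin (n + 1)) → M) :
    ∑ σ with σ (Fin.last n) = Fin.last n, F σ = ∑ τ, F (permSucc n τ) := by
  symm
  refine Finset.sum_bij (fun τ _ => permSucc n τ) ?_ ?_ ?_ fun _ _ => rfl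
  · simp
  · intro τ _ τ' _ h
    exact Equiv.Perm.viaEmbeddingHom_injective _ h
  · intro σ hσ
    obtain ⟨τ, rfl⟩ := exists_permSucc_eq (Finset.mem_filter.mp hσ).2
    exact ⟨τ, Finset.mem_univ _, rfl⟩

/-- For a class function `F`, the sum of `F σ` over the pairs of a permutation `σ` and a
fixed point of `σ`. -/
theorem sum_card_fixed_smul {M : Type*} [AddCommGroup M] [Module ℚ M]
    (F : Equiv.Perm (Fin (n + 1)) → M) (hF : ∀ σ τ, F (τ * σ * τ⁻¹) = F σ) :
    ∑ σ : Equiv.Perm (Fin (n + 1)), ((n + 1 - σ.support.card : ℕ) : ℚ) • F σ =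
      ((n : ℚ) + 1) • ∑ τ, F (permSucc n τ) := by
  have h1 : ∀ σ : Equiv.Perm (Fin (n + 1)), ((n + 1 - σ.support.card : ℕ) : ℚ) • F σ =
      ∑ j, if σ j = j then F σ else 0 := by
    intro σ
    have hc : n + 1 - σ.support.card = (Finset.univ.filter fun j => σ j = j).card := by
      have := Finset.card_compl σ.support
      rw [Fintype.card_fin] at this
      rw [← this]
      congr 1
      ext j
      simp
    rw [← Finset.sum_filter, Finset.sum_const, hc, Nat.cast_smul_eq_nsmul]
  -- Conjugation by the transposition of `j` and the last index exchanges the stabilizers of these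
  -- two points, so each `j` contributes equally.
  have h2 : ∀ j : Fin (n + 1), ∑ σ : Equiv.Perm (Fin (n + 1)), (if σ j = j then F σ else 0) =
      ∑ τ, F (permSucc n τ) := by
    intro j
    rw [← sum_fixing_last, Finset.sum_filter,
      ← Equiv.sum_comp (MulAut.conj (Equiv.swap j (Fin.last n))).toEquiv]
    refine Finset.sum_congr rfl fun σ _ => ?_
    simp only [MulEquiv.toEquiv_eq_coe, MulEquiv.coe_toEquiv, MulAut.conj_apply, hF]
    congr 1
    simp [Equiv.Perm.mul_apply, Equiv.swap_apply_eq_iff]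
  simp only [h1]
  rw [Finset.sum_comm]
  simp only [h2]
  rw [Finset.sum_const, Finset.card_univ, Fintype.card_fin, ← Nat.cast_smul_eq_nsmul ℚ]
  push_cast
  rfl

/-- The exponent of `p_1` in `p_{λ(σ)}` is the number of fixed points of `σ`, so `∂p_1` produces a
sum over pairs of a permutation and a fixed point. Moving the fixed point to the last index leaves
`n + 1` copies of a sum over `S_n`, and `(n + 1) / (n + 1)! = 1 / n!`. -/
theorem dp1_frobChar {V : Type*} [AddCommGroup V] [Module ℚ V]
    (ρ : Representation ℚ (Equiv.Perm (Fin (n + 1))) V) :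
    dp1 (frobChar ρ) = frobChar (ρ.comp (permSucc n)) := by
  -- One fixed point is removed from the cycle type. If there is none, the truncated exponent is
  -- immaterial, as `F σ` is then weighted by zero.
  let F : Equiv.Perm (Fin (n + 1)) → SymmFun := fun σ => ρ.character σ •
    ((σ.cycleType + Multiset.replicate (n + 1 - σ.support.card - 1) 1).map psumSymm).prod
  have hF : ∀ σ τ, F (τ * σ * τ⁻¹) = F σ := by
    intro σ τ
    have hχ : ρ.character (τ * σ * τ⁻¹) = ρ.character σ := by
      rw [Representation.char_mul_comm, inv_mul_cancel_left]
    simp only [F, hχ, Equiv.Perm.cycleType_conj, Equiv.Perm.card_support_conj]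
  have h1 : ∀ σ : Equiv.Perm (Fin (n + 1)),
      dp1 (ρ.character σ • (σ.partition.parts.map psumSymm).prod) =
        ((n + 1 - σ.support.card : ℕ) : ℚ) • F σ := by
    intro σ
    rw [map_smul, Equiv.Perm.parts_partition, Fintype.card_fin,
      dp1_prod_psumSymm (fun k hk => Equiv.Perm.two_le_of_mem_cycleType hk), smul_comm]
  have h2 : ∀ τ : Equiv.Perm (Fin n), F (permSucc n τ) =
      Representation.character (V := V) (ρ.comp (permSucc n)) τ • (τ.partition.parts.map psumSymm).prod := by
    intro τ
    have hc : (permSucc n τ).support.card = τ.support.card := by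
      rw [← Equiv.Perm.sum_cycleType, cycleType_permSucc, Equiv.Perm.sum_cycleType]
    simp only [F, hc, cycleType_permSucc, Equiv.Perm.parts_partition, Fintype.card_fin]
    rw [Nat.sub_right_comm, Nat.add_sub_cancel]
    rfl
  have h3 : (n.factorial : ℚ) ≠ 0 := Nat.cast_ne_zero.mpr n.factorial_ne_zero
  have h4 : (n : ℚ) + 1 ≠ 0 := by positivity
  rw [frobChar, frobChar, map_smul, map_sum]
  simp only [h1]
  rw [sum_card_fixed_smul F hF, smul_smul]
  simp only [h2]
  congr 1
  rw [Nat.factorial_succ]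
  push_cast
  field_simp

theorem frobChar_congr {V W : Type*} [AddCommGroup V] [Module ℚ V] [AddCommGroup W] [Module ℚ W]
    {ρ : Representation ℚ (Equiv.Perm (Fin n)) V} {ρ' : Representation ℚ (Equiv.Perm (Fin n)) W}
    (φ : ρ.Equiv ρ') : frobChar ρ = frobChar ρ' := by
  rw [frobChar, frobChar, Representation.char_iso φ]

end Frobenius

/-! ### The isomorphism of `S_n`-modules -/

section Isomorphism

variable {r n : ℕ}

theorem diagAction_permSucc_subLast (σ : Equiv.Perm (Fin n)) (f : Poly r n) :
    diagAction r (n + 1) (permSucc n σ) (subLast r n f) = subLast r n (diagAction r n σ f) := by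
  have h : (permVars r (permSucc n σ)).comp (subLast r n) =
      (subLast r n).comp (permVars r σ) := by
    ext ⟨u, i⟩ : 1
    simp [permVars]
  exact DFunLike.congr_fun h f

variable [NeZero r]

theorem subLast_setLastZero_of_mem {f : Poly r (n + 1)} (hf : f ∈ (Diag r (n + 1) 1).toSubmodule) :
    subLast r n (setLastZero r n f) = f := by
  rw [Diag_one_toSubmodule] at hf
  exact subLast_setLastZero
    (sum_pderiv_of_mem_harmonics (opSpan_vandermondeX_le_harmonics hf))

theorem setLastZero_mem_Diag {f : Poly r (n + 1)} (hf : f ∈ (Diag r (n + 1) 1).toSubmodule) :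
    setLastZero r n f ∈ (Diag r n (elem n n)).toSubmodule := by
  rw [Diag_one_toSubmodule] at hf
  exact map_setLastZero_opSpan.le (Submodule.mem_map_of_mem hf)

theorem subLast_mem_Diag {f : Poly r n} (hf : f ∈ (Diag r n (elem n n)).toSubmodule) :
    subLast r n f ∈ (Diag r (n + 1) 1).toSubmodule := by
  -- By surjectivity `f` is the specialization of some `g` in `Diag[n+1]`, and translation
  -- invariance of `g` makes `subLast` return `g` itself.
  obtain ⟨g, hg, rfl⟩ := map_setLastZero_opSpan.ge hf
  have hg' : g ∈ (Diag r (n + 1) 1).toSubmodule := by rwa [Diag_one_toSubmodule]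
  have h := subLast_setLastZero_of_mem hg'
  rw [← h] at hg'
  exact hg'

/-- For subrepresentations of the two polynomial rings that correspond to each other under
`subLast` and `setLastZero`, the isomorphism of `S_n`-modules given by `subLast`. -/
def equivOfSubLast (M : Subrepresentation (diagAction r n))
    (N : Subrepresentation (diagAction r (n + 1)))
    (hM : ∀ f ∈ M.toSubmodule, subLast r n f ∈ N.toSubmodule)
    (hN : ∀ f ∈ N.toSubmodule, setLastZero r n f ∈ M.toSubmodule)
    (h : ∀ f ∈ N.toSubmodule, subLast r n (setLastZero r n f) = f) :
    M.toRepresentation.Equiv (N.toRepresentation.comp (permSucc n)) :=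
  .mk (LinearEquiv.ofLinearMap ((subLast r n).toLinearMap.restrict hM)
      ((setLastZero r n).toLinearMap.restrict hN)
      (LinearMap.ext fun f => Subtype.ext (h f f.2))
      (LinearMap.ext fun f => Subtype.ext (setLastZero_subLast (f : Poly r n))))
    fun σ => by
      refine LinearMap.ext fun f => Subtype.ext ?_
      exact (diagAction_permSucc_subLast σ (f : Poly r n)).symm

end Isomorphism

end DiagonalModules

end

open DiagonalModules in
theorem mainTheorem1 (r n : ℕ) [NeZero r] :
    IsGradedByDegree (Diag r n (elem n n)) ∧
    IsGradedByDegree (Diag r (n + 1) 1) ∧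
    (∃ φ : (Diag r n (elem n n)).toRepresentation.Equiv
        ((Diag r (n + 1) 1).toRepresentation.comp (permSucc n)),
      ∀ (d : Fin r →₀ ℕ) (f : (Diag r n (elem n n)).toSubmodule),
        (f : Poly r n) ∈ homogeneousPart r n d ↔
          ((φ f : (Diag r (n + 1) 1).toSubmodule) : Poly r (n + 1)) ∈
            homogeneousPart r (n + 1) d) ∧
    gradedFrob (Diag r n (elem n n)) = dp1Series (gradedFrob (Diag r (n + 1) 1)) := by
  refine ⟨isGradedByDegree_Diag_elem, isGradedByDegree_Diag_one,
    ⟨equivOfSubLast _ _ (fun _ => subLast_mem_Diag) (fun _ => setLastZero_mem_Diag)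
      (fun _ => subLast_setLastZero_of_mem), fun d f => ?_⟩, ?_⟩
  · refine ⟨fun hf => subLast_mem_homogeneousPart hf, fun hf => ?_⟩
    rw [← setLastZero_subLast (f : Poly r n)]
    exact setLastZero_mem_homogeneousPart hf
  -- The same pair of substitutions restricts to the components of degree `d`, which gives equality
  -- of characters in each degree.
  · funext d
    refine Eq.trans ?_ (dp1_frobChar
      (Diag r (n + 1) 1 ⊓ homogeneousPart r (n + 1) d).toRepresentation).symm
    exact frobChar_congr (equivOfSubLast _ _
      (fun _ hf => ⟨subLast_mem_Diag hf.1, subLast_mem_homogeneousPart hf.2⟩)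
      (fun _ hf => ⟨setLastZero_mem_Diag hf.1, setLastZero_mem_homogeneousPart hf.2⟩)
      (fun _ hf => subLast_setLastZero_of_mem hf.1))
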